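/- Let $p$ be an odd prime, let $n$ be an odd integer divisible by $3$, and let $\mathrm{Tr}$ be the absolute trace from $\mathbb{F}_{p^n}$ to $\mathbb{F}_p$. For $f:\mathbb{F}_{p^n}\to\mathbb{F}_p$ put $\widehat f(b)=\sum_{x\in\mathbb{F}_{p^n}}\epsilon_p^{f(x)-\mathrm{Tr}(bx)}$ with $\epsilon_p=e^{2\pi i/p}$. The function $f$ is called bent if $|\widehat f(b)|^2=p^n$ for all $b\in\mathbb{F}_{p^n}$. A bent function $f$ is called weakly regular if there are $\zeta\in\mathbb{C}$ with $|\zeta|=1$ and $f^*:\mathbb{F}_{p^n}\to\mathbb{F}_p$ such that $p^{-n/2}\widehat f(b)=\zeta\,\epsilon_p^{f^*(b)}$ for all $b$, and not weakly regular otherwise. Let $\beta_1,\beta_2\in\mathbb{F}_{p^n}$ be roots of $x^{p^2}+x^p+x$ which are linearly independent over $\mathbb{F}_p$. Let $\delta\in\mathbb{F}_{p^n}$ be such that $\mathrm{Tr}(\delta\beta_1^2)=l\neq 0$ and $\mathrm{Tr}(\delta\beta_1\beta_2)=0$, and put $\gamma=l^{-1}\beta_1$. Let $\Gamma\in\mathbb{F}_{p^n}$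 be such that $\mathrm{Tr}(\delta\Gamma\beta_2)=t\neq 0$. Let $r=2^\kappa$ with an integer $\kappa\ge 1$. Put $a_0=1$, $c_0=0$, and for $1\le k\le p-1$ let $a_k\in\mathbb{F}_p^*$ be arbitrary and $$c_k=t^{-1}\left[(1-a_k)\Delta+k\right],\qquad \Delta=\mathrm{Tr}\left(\tfrac{p+1}{2}\beta_2^2+\beta_2^{p^r+1}\right),$$ where the indices $0,\dots,p-1$ are identified with the elements of $\mathbb{F}_p$. Then the function $F:\mathbb{F}_{p^n}\to\mathbb{F}_p$, $$F(x)=a_{\mathrm{Tr}(\delta\gamma x)}\,\mathrm{Tr}\left(\tfrac{p+1}{2}x^2+x^{p^r+1}\right)+c_{\mathrm{Tr}(\delta\gamma x)}\,\mathrm{Tr}(\delta\Gamma x),$$ is bent. It is not weakly regular if and only if $a_k$ is a nonsquare in $\mathbb{F}_p$ for some $1\le k\le p-1$. -/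

import Mathlib

namespace BentFunctions

variable {p : ℕ} [Fact p.Prime] {K : Type*} [Field K] [Fintype K] [Algebra (ZMod p) K]

/-- The Fourier transform of `f : 𝔽_{p^n} → 𝔽_p` at `b`, that is
`∑ x, ε_p ^ (f x - Tr (b x))` with `ε_p = exp (2 π i / p)`.
The character `ZMod.stdAddChar` sends `j` to `exp (2 π i j / p)`. -/
noncomputable def fourierTransform (f : K → ZMod p) (b : K) : ℂ :=
  ∑ x : K, ZMod.stdAddChar (f x - Algebra.trace (ZMod p) K (b * x))

/-- `f` is bent: all its Fourier coefficients have squared absolute value `p ^ n`. -/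
def IsBent (f : K → ZMod p) : Prop :=
  ∀ b : K, ‖fourierTransform f b‖ ^ 2 = (p : ℝ) ^ Module.finrank (ZMod p) K

/-- `f` is weakly regular: for some complex number `ζ` of absolute value `1` and some function
`fstar`, one has `p ^ (-n / 2) * (Fourier coefficient at b) = ζ * ε_p ^ fstar b` for all `b`. -/
def IsWeaklyRegular (f : K → ZMod p) : Prop :=
  ∃ (ζ : ℂ) (fstar : K → ZMod p), ‖ζ‖ = 1 ∧ ∀ b : K,
    (((p : ℝ) ^ (-(Module.finrank (ZMod p) K : ℝ) / 2) : ℝ) : ℂ) * fourierTransform f b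
      = ζ * ZMod.stdAddChar (fstar b)

/-- The quadratic binomial `Tr (((p + 1) / 2) x ^ 2 + x ^ (p ^ r + 1))`. The division is the one
of natural numbers, which is exact since `p` is odd wherever this is used. -/
noncomputable def quadBinomial (p : ℕ) [Fact p.Prime] {K : Type*} [Field K]
    [Algebra (ZMod p) K] (r : ℕ) (x : K) : ZMod p :=
  Algebra.trace (ZMod p) K ((((p + 1) / 2 : ℕ) : K) * x ^ 2 + x ^ (p ^ r + 1))

end BentFunctions

/-!
The binomial `Q x = Tr (x ^ 2 / 2 + x ^ (p ^ r + 1))` is a quadratic form over `ZMod p` whose polar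
form has as radical the solutions of `x ^ (p ^ (2 r)) + x ^ (p ^ r) + x = 0`. As `r` is a power of
two and the degree is odd and divisible by three, this is the same as
`x ^ (p ^ 2) + x ^ p + x = 0` (`pow_pow_add_pow_pow_add_self_iff`), so the radical is the plane
spanned by `β₁` and `β₂` (`ker_polarBilin_quadBinomialForm`). In particular `Q β₂ = 0`, so the
constant `Δ` vanishes and `c k = k / t`.

Let `f x = Tr (δ γ x)`; then `f β₁ = 1` and `f β₂ = 0`. Translation by `β₂` multiplies the
summand of the Fourier coefficient at `b` by `ψ (f x - Tr (b β₂))`, with `ψ` the standard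
character, so only the fibre `f = k` with `k = Tr (b β₂)` contributes. Completing the square there,
and using that `β₁` moves the fibres while `Q` is invariant under it, one finds that the coefficient
is `1 / p` times a `p`-th root of unity times the exponential sum of `a k * Q`
(`exists_sum_glued_quadraticForm`).

That sum has squared absolute value `p ^ (n + 2)` (`norm_sq_sum_stdAddChar_quadraticForm`), which
gives bentness. Since the rank `n - 2` is odd, it is the sum for `Q` itself times the quadratic
character of `a k` (`sum_stdAddChar_smul_quadraticForm`). Every `k` occurs for some `b`, so the
Fourier coefficients have a common phase up to `p`-th roots of unity exactly when all `a k` have the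
same quadratic character as `a 0 = 1`.
-/

namespace BentFunctions

open Module

/-! ### Exponential sums of quadratic forms over `ZMod p` -/

section GaussSums

variable {p : ℕ} [Fact p.Prime] {E : Type*} [AddCommGroup E] [Module (ZMod p) E]

theorem two_ne_zero_of_ne_two (hp : p ≠ 2) : (2 : ZMod p) ≠ 0 :=
  Ring.two_ne_zero (by rwa [ZMod.ringChar_zmod_n])

theorem map_eq_zero_of_polarBilin_eq_zero (hp : p ≠ 2) (Q : QuadraticForm (ZMod p) E) {z : E}
    (hz : Q.polarBilin z = 0) : Q z = 0 := by
  have h : QuadraticMap.polar Q z z = 0 := by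
    simpa using LinearMap.congr_fun hz z
  rw [QuadraticMap.polar_self] at h
  simpa [two_ne_zero_of_ne_two hp] using h

variable [Fintype E]

open Classical in
/-- Orthogonality of characters, for the character attached to a linear functional. -/
theorem sum_stdAddChar_linear (f : E →ₗ[ZMod p] ZMod p) :
    ∑ x, (ZMod.stdAddChar (f x) : ℂ) = if f = 0 then (Fintype.card E : ℂ) else 0 := by
  split_ifs with h
  · simp [h]
  · obtain ⟨x, hx⟩ := DFunLike.ne_iff.1 h
    refine AddChar.sum_eq_zero_of_ne_one
      (ψ := (ZMod.stdAddChar (N := p)).compAddMonoidHom f.toAddMonoidHom) fun h1 => hx ?_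
    have h2 := DFunLike.congr_fun h1 x
    apply ZMod.injective_stdAddChar
    simpa using h2

/-- The absolute value of the exponential sum of a quadratic form depends only on the dimension and on
the dimension of the radical: in the double sum over `x, y`, the substitution `x = z + y` leaves a
linear character in `y`, whose sum vanishes unless `z` lies in the radical. -/
theorem norm_sq_sum_stdAddChar_quadraticForm (hp : p ≠ 2) (Q : QuadraticForm (ZMod p) E) :
    ‖∑ x, (ZMod.stdAddChar (Q x) : ℂ)‖ ^ 2
      = (p : ℝ) ^ (finrank (ZMod p) E + finrank (ZMod p) (LinearMap.ker Q.polarBilin)) := by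
  classical
  have key : (∑ x, (ZMod.stdAddChar (Q x) : ℂ))
      * (starRingEnd ℂ) (∑ x, (ZMod.stdAddChar (Q x) : ℂ))
      = (p : ℂ) ^ (finrank (ZMod p) E + finrank (ZMod p) (LinearMap.ker Q.polarBilin)) := by
    calc
      _ = ∑ y, ∑ x, (ZMod.stdAddChar (Q x - Q y) : ℂ) := by
        simp_rw [map_sum, ← AddChar.map_neg_eq_conj, Finset.mul_sum, Finset.sum_mul,
          ← AddChar.map_add_eq_mul, ← sub_eq_add_neg]
      _ = ∑ y, ∑ z, (ZMod.stdAddChar (Q z + Q.polarBilin z y) : ℂ) := by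
        refine Finset.sum_congr rfl fun y _ => ?_
        rw [← Equiv.sum_comp (Equiv.addRight y)]
        refine Finset.sum_congr rfl fun z _ => ?_
        congr 1
        simp only [Equiv.coe_addRight, QuadraticMap.polarBilin_apply_apply, QuadraticMap.polar]
        ring
      _ = ∑ z, ZMod.stdAddChar (Q z) * ∑ y, (ZMod.stdAddChar (Q.polarBilin z y) : ℂ) := by
        rw [Finset.sum_comm]
        simp_rw [AddChar.map_add_eq_mul, Finset.mul_sum]
      _ = ∑ z, if z ∈ LinearMap.ker Q.polarBilin then (Fintype.card E : ℂ) else 0 := by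
        refine Finset.sum_congr rfl fun z _ => ?_
        rw [sum_stdAddChar_linear, LinearMap.mem_ker]
        split_ifs with h
        · simp [map_eq_zero_of_polarBilin_eq_zero hp Q h]
        · simp
      _ = _ := by
        rw [← Finset.sum_filter, Finset.sum_const, nsmul_eq_mul, ← Fintype.card_subtype,
          ← Nat.card_eq_fintype_card, ← Nat.card_eq_fintype_card,
          Module.natCard_eq_pow_finrank (K := ZMod p) (V := E)]
        erw [Module.natCard_eq_pow_finrank (K := ZMod p) (V := LinearMap.ker Q.polarBilin)]
        simp [pow_add, mul_comm]
  rw [Complex.mul_conj, Complex.normSq_eq_norm_sq] at key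
  exact_mod_cast key

theorem map_sum_stdAddChar {ι : Type*} (s : Finset ι) (f : ι → ZMod p) :
    (ZMod.stdAddChar (∑ i ∈ s, f i) : ℂ) = ∏ i ∈ s, ZMod.stdAddChar (f i) := by
  classical
  induction s using Finset.induction_on with
  | empty => simp
  | insert i s hi ih => rw [Finset.sum_insert hi, Finset.prod_insert hi, AddChar.map_add_eq_mul, ih]

/-- Counting square roots with the quadratic character turns a sum over squares into a twisted sum. -/
theorem sum_comp_sq (hp : p ≠ 2) (f : ZMod p → ℂ) :
    ∑ y, f (y ^ 2) = ∑ u, ((quadraticChar (ZMod p) u : ℂ) + 1) * f u := by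
  rw [← Finset.sum_fiberwise (g := fun y : ZMod p => y ^ 2)]
  refine Finset.sum_congr rfl fun u _ => ?_
  rw [Finset.sum_congr rfl (g := fun _ => f u) (by simp +contextual), Finset.sum_const,
    nsmul_eq_mul]
  congr 1
  have h := quadraticChar_card_sqrts (F := ZMod p) (by rwa [ZMod.ringChar_zmod_n]) u
  rw [Set.toFinset_ofPred] at h
  exact_mod_cast h

theorem sum_stdAddChar_mul_sq (hp : p ≠ 2) {a w : ZMod p} (ha : a ≠ 0) (hw : w ≠ 0) :
    ∑ y, (ZMod.stdAddChar (a * w * y ^ 2) : ℂ)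
      = quadraticChar (ZMod p) a * ∑ y, (ZMod.stdAddChar (w * y ^ 2) : ℂ) := by
  have h0 : ∀ c : ZMod p, c ≠ 0 → ∑ u, (ZMod.stdAddChar (c * u) : ℂ) = 0 := fun c hc => by
    have := AddChar.sum_mulShift c (ZMod.isPrimitive_stdAddChar p)
    simpa [hc, mul_comm] using this
  rw [sum_comp_sq hp fun u => ZMod.stdAddChar (a * w * u),
    sum_comp_sq hp fun u => ZMod.stdAddChar (w * u)]
  simp_rw [add_mul, one_mul, Finset.sum_add_distrib]
  rw [h0 _ (mul_ne_zero ha hw), h0 _ hw, add_zero, add_zero,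
    ← Equiv.sum_comp (Equiv.mulLeft₀ a ha) fun u =>
      (quadraticChar (ZMod p) u : ℂ) * ZMod.stdAddChar (w * u), Finset.mul_sum]
  refine Finset.sum_congr rfl fun u _ => ?_
  have h1 : (quadraticChar (ZMod p) a : ℂ) * quadraticChar (ZMod p) a = 1 := by
    have := quadraticChar_sq_one ha
    rw [sq] at this
    exact_mod_cast this
  simp only [Equiv.mulLeft₀_apply, map_mul, Int.cast_mul]
  rw [← mul_assoc, ← mul_assoc, h1, one_mul, ← mul_assoc, mul_comm w a]

theorem norm_sq_sum_stdAddChar_mul_sq (hp : p ≠ 2) {w : ZMod p} (hw : w ≠ 0) :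
    ‖∑ y, (ZMod.stdAddChar (w * y ^ 2) : ℂ)‖ ^ 2 = p := by
  let Q : QuadraticForm (ZMod p) (ZMod p) := w • QuadraticMap.sq
  have hQ : ∀ y, Q y = w * y ^ 2 := fun y => by simp [Q, sq]
  have h := norm_sq_sum_stdAddChar_quadraticForm hp Q
  have hk : LinearMap.ker Q.polarBilin = ⊥ := by
    rw [Submodule.eq_bot_iff]
    intro x hx
    have h1 := LinearMap.congr_fun (LinearMap.mem_ker.1 hx) 1
    have h2 : w * (2 * x) = 0 := by
      simp only [QuadraticMap.polarBilin_apply_apply, QuadraticMap.polar, hQ,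
        LinearMap.zero_apply] at h1
      linear_combination h1
    simpa [hw, two_ne_zero_of_ne_two hp] using h2
  rw [hk] at h
  simpa [hQ] using h

/-- Scaling a quadratic form by `a` multiplies its exponential sum by the quadratic character of `a`
raised to the rank. After diagonalization the sum is a product of one-variable Gauss sums, and the
number of nonzero diagonal entries is read off from the absolute value. -/
theorem sum_stdAddChar_smul_quadraticForm (hp : p ≠ 2) (Q : QuadraticForm (ZMod p) E)
    {a : ZMod p} (ha : a ≠ 0) :
    ∑ x, (ZMod.stdAddChar (a * Q x) : ℂ)
      = (quadraticChar (ZMod p) a : ℂ) ^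
          (finrank (ZMod p) E - finrank (ZMod p) (LinearMap.ker Q.polarBilin))
        * ∑ x, (ZMod.stdAddChar (Q x) : ℂ) := by
  classical
  have : Invertible (2 : ZMod p) := invertibleOfNonzero (two_ne_zero_of_ne_two hp)
  obtain ⟨w, ⟨e⟩⟩ := Q.equivalent_weightedSumSquares
  have hprod : ∀ a : ZMod p, ∑ x, (ZMod.stdAddChar (a * Q x) : ℂ)
      = ∏ i, ∑ y : ZMod p, (ZMod.stdAddChar (a * w i * y ^ 2) : ℂ) := fun a => by
    rw [Fintype.prod_sum, ← Equiv.sum_comp e.toLinearEquiv.toEquiv]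
    refine Finset.sum_congr rfl fun x _ => ?_
    have hx : Q x = QuadraticMap.weightedSumSquares (ZMod p) w (e x) := (e.map_app x).symm
    rw [hx, QuadraticMap.weightedSumSquares_apply, Finset.mul_sum, map_sum_stdAddChar]
    refine Finset.prod_congr rfl fun i _ => ?_
    congr 1
    simp [sq, mul_assoc]
  -- `m` is the number of nonzero diagonal entries; each of them contributes one factor `χ a`.
  set m := (Finset.univ.filter fun i => w i ≠ 0).card with hm
  have hw : ∀ a : ZMod p, a ≠ 0 → ∑ x, (ZMod.stdAddChar (a * Q x) : ℂ)
      = (quadraticChar (ZMod p) a : ℂ) ^ m * ∑ x, (ZMod.stdAddChar (Q x) : ℂ) := fun a ha => by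
    have h1 := hprod 1
    simp only [one_mul] at h1
    rw [hprod, h1, hm, ← Finset.prod_const, Finset.prod_filter, ← Finset.prod_mul_distrib]
    refine Finset.prod_congr rfl fun i _ => ?_
    split_ifs with h
    · exact sum_stdAddChar_mul_sq hp ha h
    · simp [not_not.1 h]
  -- Comparing `p ^ (m + 2 (d - m))` with `p ^ (d + dim rad)`, for `d` the dimension, gives `m`.
  have hmcard : m = finrank (ZMod p) E - finrank (ZMod p) (LinearMap.ker Q.polarBilin) := by
    have h1 := hprod 1
    simp only [one_mul] at h1
    have h2 := norm_sq_sum_stdAddChar_quadraticForm hp Q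
    have hp1 : 1 < p := (Fact.out : p.Prime).one_lt
    have h3 : ∏ i, ‖∑ y : ZMod p, (ZMod.stdAddChar (w i * y ^ 2) : ℂ)‖ ^ 2
        = (p : ℝ) ^ (m + 2 * (finrank (ZMod p) E - m)) := by
      rw [← Finset.prod_filter_mul_prod_filter_not Finset.univ fun i => w i ≠ 0, pow_add]
      congr 1
      · rw [Finset.prod_congr rfl (g := fun _ => (p : ℝ)), Finset.prod_const]
        intro i hi
        exact norm_sq_sum_stdAddChar_mul_sq hp (Finset.mem_filter.1 hi).2
      · rw [Finset.prod_congr rfl (g := fun _ => (p : ℝ) ^ 2), Finset.prod_const, ← pow_mul]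
        · congr 2
          have := Finset.card_filter_add_card_filter_not (s := Finset.univ) fun i => w i ≠ 0
          simp only [Finset.card_univ, Fintype.card_fin] at this
          omega
        · intro i hi
          simp [not_not.1 (Finset.mem_filter.1 hi).2, ZMod.card]
    rw [h1, norm_prod, ← Finset.prod_pow, h3] at h2
    have h4 := pow_right_injective₀ (a := (p : ℝ)) (by positivity) (by exact_mod_cast hp1.ne') h2
    have h5 : m ≤ finrank (ZMod p) E := by
      simpa using Finset.card_filter_le (Finset.univ) fun i => w i ≠ 0
    have h6 := Submodule.finrank_le (LinearMap.ker Q.polarBilin)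
    omega
  rw [← hmcard]
  exact hw a ha

end GaussSums

/-! ### Quadratic forms glued along parallel hyperplanes -/

section Fibres

variable {p : ℕ} [Fact p.Prime] {E : Type*} [AddCommGroup E] [Module (ZMod p) E] [Fintype E]

/-- Every linear functional vanishing on the radical is represented by the polar form. -/
theorem exists_polarBilin_eq (Q : QuadraticForm (ZMod p) E) (f : E →ₗ[ZMod p] ZMod p)
    (hf : ∀ z, Q.polarBilin z = 0 → f z = 0) : ∃ y, Q.polarBilin y = f := by
  have h : f ∈ LinearMap.range Q.polarBilin.dualMap := by
    rw [LinearMap.range_dualMap_eq_dualAnnihilator_ker, Submodule.mem_dualAnnihilator]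
    exact fun z hz => hf z hz
  obtain ⟨ψ, hψ⟩ := h
  obtain ⟨y, rfl⟩ := (Module.evalEquiv (ZMod p) E).surjective ψ
  refine ⟨y, ?_⟩
  rw [← hψ]
  ext x
  simp [QuadraticMap.polar_comm Q x y]

/-- A function invariant under a direction transverse to the fibres of `f` has the same sum on each of
them. -/
theorem card_mul_sum_fibre (f : E →ₗ[ZMod p] ZMod p) {v : E} (hv : f v = 1) (W : E → ℂ)
    (hW : ∀ x (s : ZMod p), W (x + s • v) = W x) (k : ZMod p) :
    (p : ℂ) * ∑ x, (if f x = k then W x else 0) = ∑ x, W x := by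
  have h : ∀ j, ∑ x, (if f x = j then W x else 0) = ∑ x, (if f x = k then W x else 0) :=
    fun j => by
      rw [← Equiv.sum_comp (Equiv.addRight ((j - k) • v))]
      refine Finset.sum_congr rfl fun x _ => ?_
      have : f x + (j - k) = j ↔ f x = k := by
        rw [← eq_sub_iff_add_eq, sub_sub_cancel]
      simp only [Equiv.coe_addRight, map_add, map_smul, hv, smul_eq_mul, mul_one, hW, this]
  calc
    _ = ∑ j : ZMod p, ∑ x, (if f x = j then W x else 0) := by
      simp_rw [h]
      simp [ZMod.card]
    _ = _ := by
      rw [Finset.sum_comm]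
      simp

/-- On the fibre `f = k`, the translation by `v` multiplies `G` by the constant `ψ (k - k0)`, where `ψ`
is the standard character; so the sum over the fibre vanishes unless `k = k0`. -/
theorem sum_fibre_eq_zero (f : E →ₗ[ZMod p] ZMod p) {v : E} (hv : f v = 0) (G : E → ℂ)
    (k0 : ZMod p) (hG : ∀ x, G (x + v) = ZMod.stdAddChar (f x - k0) * G x) {k : ZMod p}
    (hk : k ≠ k0) : ∑ x, (if f x = k then G x else 0) = 0 := by
  have h : ∑ x, (if f x = k then G x else 0)
      = ZMod.stdAddChar (k - k0) * ∑ x, (if f x = k then G x else 0) := by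
    conv_lhs => rw [← Equiv.sum_comp (Equiv.addRight v)]
    rw [Finset.mul_sum]
    refine Finset.sum_congr rfl fun x _ => ?_
    simp only [Equiv.coe_addRight, map_add, hv, add_zero, hG]
    split_ifs with h
    · rw [h]
    · simp
  by_contra h0
  refine hk (sub_eq_zero.1 (ZMod.injective_stdAddChar ?_))
  rw [AddChar.map_zero_eq_one]
  exact (mul_eq_right₀ h0).1 h.symm

/-- The function `x ↦ a (f x) * Q x + f x * g x` glues multiples of `Q` along the hyperplanes `f = k`.
Its Fourier coefficient at `b` is, up to the factor `1 / p` and a `p`-th root of unity, the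
exponential sum of a single multiple of `Q`, the one belonging to the value `b v₂`. -/
theorem exists_sum_glued_quadraticForm (hp : p ≠ 2) (Q : QuadraticForm (ZMod p) E) {v₁ v₂ : E}
    (hker : LinearMap.ker Q.polarBilin = Submodule.span (ZMod p) {v₁, v₂})
    (f g : E →ₗ[ZMod p] ZMod p) (hf₁ : f v₁ = 1) (hf₂ : f v₂ = 0) (hg : g v₂ = 1)
    (a : ZMod p → ZMod p) (ha : ∀ k, a k ≠ 0) (b : E →ₗ[ZMod p] ZMod p) :
    ∃ h : ZMod p, ∑ x, (ZMod.stdAddChar (a (f x) * Q x + f x * g x - b x) : ℂ)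
      = (p : ℂ)⁻¹ * ZMod.stdAddChar h * ∑ x, (ZMod.stdAddChar (a (b v₂) * Q x) : ℂ) := by
  have hp0 : (p : ℂ) ≠ 0 := by exact_mod_cast (Fact.out : p.Prime).ne_zero
  have hv₁ : Q.polarBilin v₁ = 0 := by
    rw [← LinearMap.mem_ker, hker]; exact Submodule.subset_span (by simp)
  have hv₂ : Q.polarBilin v₂ = 0 := by
    rw [← LinearMap.mem_ker, hker]; exact Submodule.subset_span (by simp)
  have hinv : ∀ v, Q.polarBilin v = 0 → ∀ (s : ZMod p) x, Q (x + s • v) = Q x :=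
    fun v hv s x => by
      have h1 : QuadraticMap.polar Q v x = 0 := by simpa using LinearMap.congr_fun hv x
      rw [QuadraticMap.map_add Q, QuadraticMap.map_smul, map_eq_zero_of_polarBilin_eq_zero hp Q hv,
        QuadraticMap.polar_smul_right, QuadraticMap.polar_comm, h1]
      simp
  -- Only the fibre `f = b v₂` contributes. On it `f` is constant, so a multiple of `f` may be added
  -- to the linear part `k • g - b`; the multiple `c` makes it vanish on the radical.
  set k := b v₂ with hk
  set c := b v₁ - k * g v₁ with hc
  obtain ⟨y, hy⟩ := exists_polarBilin_eq Q ((a k)⁻¹ • (k • g - b + c • f)) (by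
    intro z hz
    have : z ∈ Submodule.span (ZMod p) {v₁, v₂} := by rw [← hker]; exact hz
    obtain ⟨s, t, rfl⟩ := Submodule.mem_span_pair.1 this
    simp only [LinearMap.smul_apply, LinearMap.add_apply, LinearMap.sub_apply, map_add, map_smul,
      smul_eq_mul, hf₁, hf₂, hg, ← hk, hc]
    ring)
  have hy' : ∀ x, a k * QuadraticMap.polar Q y x = k * g x - b x + c * f x := fun x => by
    have h1 := LinearMap.congr_fun hy x
    simp only [QuadraticMap.polarBilin_apply_apply, LinearMap.smul_apply, LinearMap.add_apply,
      LinearMap.sub_apply, smul_eq_mul] at h1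
    rw [h1, mul_inv_cancel_left₀ (ha k)]
  refine ⟨-(a k * Q y) - c * k, ?_⟩
  set G : E → ℂ := fun x => ZMod.stdAddChar (a (f x) * Q x + f x * g x - b x) with hG
  have hfib : ∑ x, G x = ∑ x, (if f x = k then G x else 0) := by
    calc
      _ = ∑ j, ∑ x, (if f x = j then G x else 0) := by
        rw [Finset.sum_comm]
        simp
      _ = _ := by
        refine Finset.sum_eq_single k (fun j _ hj => ?_) (by simp)
        refine sum_fibre_eq_zero f hf₂ G k (fun x => ?_) hj
        have h1 := hinv v₂ hv₂ 1 x
        rw [one_smul] at h1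
        simp only [hG, map_add, hf₂, hg, h1, ← hk, ← AddChar.map_add_eq_mul]
        congr 1
        ring_nf
  rw [hfib]
  -- Completing the square replaces `x` by `x + y`, and the fibre sum is `1 / p` of the full sum
  -- because `Q` is invariant under `v₁`, which is transverse to the fibres.
  have hW := card_mul_sum_fibre f hf₁ (fun x => (ZMod.stdAddChar (a k * Q (x + y)) : ℂ))
    (fun x s => by
      have h1 := hinv v₁ hv₁ s (x + y)
      rw [add_right_comm] at h1
      simp only [h1]) k
  have hshift : ∑ x, (ZMod.stdAddChar (a k * Q (x + y)) : ℂ)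
      = ∑ x, (ZMod.stdAddChar (a k * Q x) : ℂ) :=
    Equiv.sum_comp (Equiv.addRight y) fun x => (ZMod.stdAddChar (a k * Q x) : ℂ)
  rw [hshift] at hW
  rw [← hW, mul_right_comm, inv_mul_cancel_left₀ hp0, Finset.sum_mul]
  refine Finset.sum_congr rfl fun x _ => ?_
  split_ifs with hx
  · simp only [hG, hx, ← AddChar.map_add_eq_mul]
    congr 1
    have h1 := hy' x
    rw [hx] at h1
    rw [QuadraticMap.map_add Q x y, QuadraticMap.polar_comm Q x y]
    linear_combination -h1
  · simp

end Fibres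

/-! ### The radical of the quadratic binomial -/

section Kernel

variable {p : ℕ} [Fact p.Prime] {K : Type*} [Field K] [Fintype K] [Algebra (ZMod p) K]

theorem frobenius_pow_apply (r : ℕ) (x : K) :
    (FiniteField.frobeniusAlgEquivOfAlgebraic (ZMod p) K ^ r) x = x ^ p ^ r := by
  rw [AlgEquiv.coe_pow, FiniteField.coe_frobeniusAlgEquivOfAlgebraic_iterate, ZMod.card]

/-- `quadBinomial p r` as a quadratic form: the diagonal of the bilinear form
`Tr ((x / 2 + x ^ (p ^ r)) y)`, where `(p + 1) / 2` stands for `1 / 2`. -/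
noncomputable def quadBinomialForm (p : ℕ) [Fact p.Prime] (K : Type*) [Field K] [Fintype K]
    [Algebra (ZMod p) K] (r : ℕ) : QuadraticForm (ZMod p) K :=
  LinearMap.BilinMap.toQuadraticMap (Algebra.traceForm (ZMod p) K ∘ₗ
    ((((p + 1) / 2 : ℕ) : ZMod p) • LinearMap.id +
      (FiniteField.frobeniusAlgEquivOfAlgebraic (ZMod p) K ^ r).toLinearMap))

theorem quadBinomialForm_apply (r : ℕ) (x : K) :
    quadBinomialForm p K r x = quadBinomial p r x := by
  rw [quadBinomialForm, quadBinomial, LinearMap.BilinMap.toQuadraticMap_apply]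
  simp only [LinearMap.comp_apply, Algebra.traceForm_apply, LinearMap.add_apply,
    LinearMap.smul_apply, LinearMap.id_apply, AlgEquiv.toLinearMap_apply, frobenius_pow_apply]
  rw [Algebra.smul_def, map_natCast, add_mul, mul_assoc, sq, pow_succ]

/-- The polar form, with the Frobenius power moved onto `y` by the invariance of the trace. -/
theorem polar_quadBinomialForm (hp : p ≠ 2) (r : ℕ) (x y : K) :
    QuadraticMap.polar (quadBinomialForm p K r) x y
      = Algebra.trace (ZMod p) K ((x ^ p ^ (2 * r) + x ^ p ^ r + x) * y ^ p ^ r) := by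
  set φ := FiniteField.frobeniusAlgEquivOfAlgebraic (ZMod p) K ^ r with hφ
  have hφx : ∀ x : K, φ x = x ^ p ^ r := frobenius_pow_apply r
  have hφφ : ∀ x : K, φ (φ x) = x ^ p ^ (2 * r) := fun x => by
    rw [hφx, hφx, ← pow_mul, ← pow_add, two_mul]
  have htr : ∀ z : K, Algebra.trace (ZMod p) K (φ z) = Algebra.trace (ZMod p) K z :=
    Algebra.trace_eq_of_algEquiv φ
  have h2 : 2 * (((p + 1) / 2 : ℕ) : ZMod p) = 1 := by
    have h := Nat.mul_div_cancel' (((Fact.out : p.Prime).odd_of_ne_two hp).add_one.two_dvd)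
    have := congrArg (Nat.cast (R := ZMod p)) h
    push_cast at this
    simpa using this
  rw [quadBinomialForm, LinearMap.BilinMap.polar_toQuadraticMap, ← hφφ, ← hφx, ← hφx]
  simp only [LinearMap.comp_apply, Algebra.traceForm_apply, LinearMap.add_apply,
    LinearMap.smul_apply, LinearMap.id_apply, AlgEquiv.toLinearMap_apply, ← hφ, add_mul, map_add,
    map_smul, smul_eq_mul]
  rw [← map_mul φ (φ x), ← map_mul φ x y, htr, htr, mul_comm y x, mul_comm (φ y) x]
  linear_combination Algebra.trace (ZMod p) K (x * y) * h2

theorem polarBilin_quadBinomialForm_eq_zero_iff (hp : p ≠ 2) (r : ℕ) (x : K) :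
    (quadBinomialForm p K r).polarBilin x = 0 ↔ x ^ p ^ (2 * r) + x ^ p ^ r + x = 0 := by
  constructor
  · intro h
    refine (traceForm_nondegenerate (ZMod p) K).1 _ fun z => ?_
    obtain ⟨y, rfl⟩ := (FiniteField.frobeniusAlgEquivOfAlgebraic (ZMod p) K ^ r).surjective z
    rw [Algebra.traceForm_apply, frobenius_pow_apply, ← polar_quadBinomialForm hp]
    simpa using LinearMap.congr_fun h y
  · intro h
    ext y
    simp [polar_quadBinomialForm hp, h]

/-- For a power of two as exponent, the radical equation does not depend on it: the roots of either
equation are fixed by the cube of the Frobenius, modulo which `2 ^ κ` and `2 * 2 ^ κ` are `1` and `2`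
in some order. -/
theorem pow_pow_add_pow_pow_add_self_iff (hn_odd : Odd (finrank (ZMod p) K))
    (hn3 : 3 ∣ finrank (ZMod p) K) (κ : ℕ) (x : K) :
    x ^ p ^ (2 * 2 ^ κ) + x ^ p ^ 2 ^ κ + x = 0 ↔ x ^ p ^ 2 + x ^ p + x = 0 := by
  set n := finrank (ZMod p) K with hn
  set φ := FiniteField.frobeniusAlgEquivOfAlgebraic (ZMod p) K with hφ
  have hφx : ∀ r, (φ ^ r) x = x ^ p ^ r := fun r => frobenius_pow_apply r x
  -- A root is fixed by `φ ^ (3 r)`, hence by `φ ^ 3`, as `gcd (3 * 2 ^ κ, n) = 3`.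
  have hcube : ∀ r, (φ ^ (2 * r)) x + (φ ^ r) x + x = 0 → (φ ^ (3 * r)) x = x := fun r h => by
    have h1 := congrArg (φ ^ r) h
    simp only [map_add, map_zero, ← AlgEquiv.mul_apply, ← pow_add] at h1
    rw [show r + 2 * r = 3 * r by ring, show r + r = 2 * r by ring] at h1
    linear_combination h1 - h
  have hcard : (φ ^ n) x = x := by
    rw [hφx]
    have h1 := FiniteField.pow_card x
    rwa [← Nat.card_eq_fintype_card, Module.natCard_eq_pow_finrank (K := ZMod p) (V := K),
      Nat.card_zmod] at h1
  have hgcd : Nat.gcd (3 * 2 ^ κ) n = 3 := by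
    obtain ⟨m, hm⟩ := hn3
    have hmo : Odd m := by rw [hm] at hn_odd; exact (Nat.odd_mul.1 hn_odd).2
    rw [hm, Nat.gcd_mul_left, (Nat.Coprime.pow_left κ (Nat.coprime_two_left.2 hmo)).gcd_eq_one,
      mul_one]
  have hfix : ∀ i j, (φ ^ i) x = x → (φ ^ j) x = x → (φ ^ Nat.gcd i j) x = x := fun i j hi hj => by
    have e : ∀ i, (φ ^ i) x = φ^[i] x := fun i => by rw [AlgEquiv.coe_pow]
    rw [e] at *
    exact Function.IsPeriodicPt.gcd hi hj
  have hmod : (φ ^ 3) x = x → ∀ i, (φ ^ i) x = (φ ^ (i % 3)) x := fun h i => by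
    have e : ∀ i, (φ ^ i) x = φ^[i] x := fun i => by rw [AlgEquiv.coe_pow]
    rw [e] at *
    rw [e]
    exact (Function.IsPeriodicPt.iterate_mod_apply (f := φ) h i).symm
  have hpow : 2 ^ κ % 3 = 1 ∧ 2 * 2 ^ κ % 3 = 2 ∨ 2 ^ κ % 3 = 2 ∧ 2 * 2 ^ κ % 3 = 1 := by
    have h1 : ¬ 3 ∣ 2 ^ κ := fun h => by
      have := Nat.Prime.dvd_of_dvd_pow Nat.prime_three h
      omega
    omega
  have key : (φ ^ 3) x = x → ((φ ^ (2 * 2 ^ κ)) x + (φ ^ 2 ^ κ) x + x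
      = (φ ^ 2) x + (φ ^ 1) x + x) := fun h => by
    rw [hmod h (2 * 2 ^ κ), hmod h (2 ^ κ)]
    rcases hpow with ⟨h1, h2⟩ | ⟨h1, h2⟩
    · rw [h1, h2]
    · rw [h1, h2, add_comm ((φ ^ 1) x)]
  rw [← hφx, ← hφx, ← hφx, show x ^ p = (φ ^ 1) x by rw [hφx, pow_one]]
  constructor
  · intro h
    rw [← key, h]
    rw [← hgcd]
    exact hfix _ _ (hcube _ h) hcard
  · intro h
    rw [key, h]
    exact hcube 1 h

theorem ker_polarBilin_quadBinomialForm (hp : p ≠ 2) (hn_odd : Odd (finrank (ZMod p) K))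
    (hn3 : 3 ∣ finrank (ZMod p) K) (κ : ℕ) {β₁ β₂ : K} (hβ₁ : β₁ ^ p ^ 2 + β₁ ^ p + β₁ = 0)
    (hβ₂ : β₂ ^ p ^ 2 + β₂ ^ p + β₂ = 0) (hβ : LinearIndependent (ZMod p) ![β₁, β₂]) :
    LinearMap.ker (quadBinomialForm p K (2 ^ κ)).polarBilin
      = Submodule.span (ZMod p) {β₁, β₂} := by
  classical
  have hmem : ∀ x, x ∈ LinearMap.ker (quadBinomialForm p K (2 ^ κ)).polarBilin ↔
      x ^ p ^ 2 + x ^ p + x = 0 := fun x => by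
    rw [LinearMap.mem_ker, polarBilin_quadBinomialForm_eq_zero_iff hp,
      pow_pow_add_pow_pow_add_self_iff hn_odd hn3]
  have hp1 : 1 < p := (Fact.out : p.Prime).one_lt
  symm
  apply Submodule.eq_of_le_of_finrank_le
  · rw [Submodule.span_le]
    rintro x (rfl | rfl)
    · exact (hmem _).2 hβ₁
    · exact (hmem _).2 hβ₂
  · have h2 : finrank (ZMod p) (Submodule.span (ZMod p) {β₁, β₂}) = 2 := by
      have := finrank_span_eq_card hβ
      rw [Matrix.range_cons_cons_empty] at this
      simpa using this
    rw [h2]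
    -- The radical consists of roots of a polynomial of degree `p ^ 2`.
    open Polynomial in
    let P : K[X] := X ^ p ^ 2 + (X ^ p + X)
    have hlt : p < p ^ 2 := by nlinarith
    have hdeg : P.natDegree = p ^ 2 := by
      rw [Polynomial.natDegree_add_eq_left_of_natDegree_lt, Polynomial.natDegree_X_pow]
      rw [Polynomial.natDegree_X_pow]
      refine lt_of_le_of_lt (Polynomial.natDegree_add_le_of_degree_le ?_ ?_) hlt
      · rw [Polynomial.natDegree_X_pow]
      · rw [Polynomial.natDegree_X]; exact hp1.le
    have hP0 : P ≠ 0 := fun h => by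
      rw [h, Polynomial.natDegree_zero] at hdeg
      nlinarith
    have hcard := Polynomial.card_le_degree_of_subset_roots (p := P)
      (Z := Finset.univ.filter fun x => x ∈ LinearMap.ker
        (quadBinomialForm p K (2 ^ κ)).polarBilin) (fun x hx => by
          have h1 := (hmem x).1 (Finset.mem_filter.1 hx).2
          rw [Polynomial.mem_roots hP0, Polynomial.IsRoot.def]
          simpa [P, add_assoc] using h1)
    rw [hdeg, ← Fintype.card_subtype, ← Nat.card_eq_fintype_card] at hcard
    erw [Module.natCard_eq_pow_finrank (K := ZMod p)
      (V := LinearMap.ker (quadBinomialForm p K (2 ^ κ)).polarBilin)] at hcard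
    rw [Nat.card_zmod] at hcard
    exact (Nat.pow_le_pow_iff_right hp1).1 hcard

end Kernel

/-! ### Weak regularity -/

section WeakRegularity

variable {p : ℕ} [Fact p.Prime]

theorem stdAddChar_ne_neg_one (hp : p ≠ 2) (j : ZMod p) : (ZMod.stdAddChar j : ℂ) ≠ -1 := by
  intro h
  have h1 : (ZMod.stdAddChar j : ℂ) ^ p = 1 := by
    rw [← AddChar.map_nsmul_eq_pow]
    simp
  rw [h, ((Fact.out : p.Prime).odd_of_ne_two hp).neg_one_pow] at h1
  norm_num at h1

variable {K : Type*} [Field K] [Fintype K] [Algebra (ZMod p) K]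

/-- Two Fourier coefficients whose ratio is `-1` times a `p`-th root of unity exclude weak regularity,
since `-1` is not a `p`-th root of unity for odd `p`. -/
theorem not_isWeaklyRegular_of_opposite (hp : p ≠ 2) {f : K → ZMod p} {C : ℂ} (hC : C ≠ 0)
    {b b' : K} {h h' : ZMod p} (hb : fourierTransform f b = C * ZMod.stdAddChar h)
    (hb' : fourierTransform f b' = -C * ZMod.stdAddChar h') : ¬ IsWeaklyRegular f := by
  rintro ⟨ζ, fstar, -, hf⟩
  have hp0 : (0 : ℝ) < p := by exact_mod_cast (Fact.out : p.Prime).pos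
  set D : ℂ := (((p : ℝ) ^ (-(finrank (ZMod p) K : ℝ) / 2) : ℝ) : ℂ) with hD
  have hD0 : D ≠ 0 := by
    rw [hD, Complex.ofReal_ne_zero]
    positivity
  have hinv : ∀ j : ZMod p, (ZMod.stdAddChar j : ℂ) * ZMod.stdAddChar (-j) = 1 := fun j => by
    rw [← AddChar.map_add_eq_mul, add_neg_cancel, AddChar.map_zero_eq_one]
  have e1 := hf b
  have e2 := hf b'
  rw [hb] at e1
  rw [hb'] at e2
  refine stdAddChar_ne_neg_one hp ((fstar b' - h') - (fstar b - h)) ?_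
  have hζ : D * C = ζ * ZMod.stdAddChar (fstar b - h) := by
    rw [sub_eq_add_neg, AddChar.map_add_eq_mul]
    linear_combination ZMod.stdAddChar (-h) * e1 - D * C * hinv h
  have hζ' : -(D * C) = ζ * ZMod.stdAddChar (fstar b' - h') := by
    rw [sub_eq_add_neg, AddChar.map_add_eq_mul]
    linear_combination ZMod.stdAddChar (-h') * e2 + D * C * hinv h'
  refine mul_left_cancel₀ (mul_ne_zero hD0 hC) ?_
  rw [sub_eq_add_neg, AddChar.map_add_eq_mul]
  linear_combination ZMod.stdAddChar (fstar b' - h') * ZMod.stdAddChar (-(fstar b - h)) * hζ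
    - hζ' + ζ * ZMod.stdAddChar (fstar b' - h') * hinv (fstar b - h)

theorem isWeaklyRegular_of_eq_mul_stdAddChar {f : K → ZMod p} {C : ℂ}
    (hC : ‖C‖ ^ 2 = (p : ℝ) ^ finrank (ZMod p) K) (h : K → ZMod p)
    (hf : ∀ b, fourierTransform f b = C * ZMod.stdAddChar (h b)) : IsWeaklyRegular f := by
  have hp0 : (0 : ℝ) < p := by exact_mod_cast (Fact.out : p.Prime).pos
  refine ⟨(((p : ℝ) ^ (-(finrank (ZMod p) K : ℝ) / 2) : ℝ) : ℂ) * C, h, ?_, fun b => ?_⟩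
  · rw [← sq_eq_sq₀ (norm_nonneg _) zero_le_one, norm_mul, mul_pow, hC, Complex.norm_real,
      Real.norm_of_nonneg (by positivity), ← Real.rpow_natCast, ← Real.rpow_natCast,
      ← Real.rpow_mul hp0.le, ← Real.rpow_add hp0]
    norm_num
  · rw [hf, mul_assoc]

end WeakRegularity

end BentFunctions

/-! ### The glued binomial -/

theorem mainTheorem5 (p : ℕ) [Fact p.Prime] (hp : p ≠ 2) (n : ℕ) (hn_odd : Odd n) (hn3 : 3 ∣ n)
    (K : Type*) [Field K] [Fintype K] [Algebra (ZMod p) K]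
    (hK : Module.finrank (ZMod p) K = n)
    (β₁ β₂ : K) (hβ₁ : β₁ ^ (p ^ 2) + β₁ ^ p + β₁ = 0) (hβ₂ : β₂ ^ (p ^ 2) + β₂ ^ p + β₂ = 0)
    (hβ : LinearIndependent (ZMod p) ![β₁, β₂])
    (δ : K) (l : ZMod p) (hl : Algebra.trace (ZMod p) K (δ * β₁ ^ 2) = l) (hl0 : l ≠ 0)
    (hδ : Algebra.trace (ZMod p) K (δ * β₁ * β₂) = 0)
    (γ : K) (hγ : γ = l⁻¹ • β₁)
    (Γ : K) (t : ZMod p) (ht : Algebra.trace (ZMod p) K (δ * Γ * β₂) = t) (ht0 : t ≠ 0)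
    (κ r : ℕ) (hκ : 1 ≤ κ) (hr : r = 2 ^ κ)
    (a c : ZMod p → ZMod p) (ha0 : a 0 = 1) (ha : ∀ k, k ≠ 0 → a k ≠ 0)
    (hc0 : c 0 = 0)
    (hc : ∀ k, k ≠ 0 → c k = t⁻¹ * ((1 - a k) * BentFunctions.quadBinomial p r β₂ + k))
    (F : K → ZMod p)
    (hF : ∀ x, F x =
      a (Algebra.trace (ZMod p) K (δ * γ * x)) * BentFunctions.quadBinomial p r x
        + c (Algebra.trace (ZMod p) K (δ * γ * x)) * Algebra.trace (ZMod p) K (δ * Γ * x)) :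
    BentFunctions.IsBent F ∧
      (¬ BentFunctions.IsWeaklyRegular F ↔ ∃ k : ZMod p, k ≠ 0 ∧ ¬ IsSquare (a k)) := by
  open BentFunctions Module in
  subst hr hK
  have hp0 : (p : ℝ) ≠ 0 := by exact_mod_cast (Fact.out : p.Prime).ne_zero
  set Q := quadBinomialForm p K (2 ^ κ) with hQ
  have hker : LinearMap.ker Q.polarBilin = Submodule.span (ZMod p) {β₁, β₂} :=
    ker_polarBilin_quadBinomialForm hp hn_odd hn3 κ hβ₁ hβ₂ hβ
  have hrank : finrank (ZMod p) (LinearMap.ker Q.polarBilin) = 2 := by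
    have h := finrank_span_eq_card hβ
    rw [Matrix.range_cons_cons_empty] at h
    rw [hker]
    simpa using h
  have ha' : ∀ k, a k ≠ 0 := fun k => by
    by_cases hk : k = 0
    · rw [hk, ha0]; exact one_ne_zero
    · exact ha k hk
  -- The constant `Δ` vanishes, because `β₂` lies in the radical of `Q`.
  have hQβ₂ : quadBinomial p (2 ^ κ) β₂ = 0 := by
    rw [← quadBinomialForm_apply]
    refine map_eq_zero_of_polarBilin_eq_zero hp Q ?_
    rw [← LinearMap.mem_ker, hker]
    exact Submodule.subset_span (by simp)
  have hc' : ∀ k, c k = k * t⁻¹ := fun k => by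
    by_cases hk : k = 0
    · rw [hk, hc0, zero_mul]
    · rw [hc k hk, hQβ₂]; ring
  let T : K → K →ₗ[ZMod p] ZMod p := fun z => Algebra.traceForm (ZMod p) K z
  have hT : ∀ z x, T z x = Algebra.trace (ZMod p) K (z * x) := fun z x => rfl
  have hf₁ : T (δ * γ) β₁ = 1 := by
    rw [hT, hγ, show δ * l⁻¹ • β₁ * β₁ = l⁻¹ • (δ * β₁ ^ 2) by
      rw [mul_smul_comm, smul_mul_assoc, sq, mul_assoc], map_smul, hl, smul_eq_mul,
      inv_mul_cancel₀ hl0]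
  have hf₂ : T (δ * γ) β₂ = 0 := by
    rw [hT, hγ, mul_smul_comm, smul_mul_assoc, map_smul, hδ, smul_zero]
  have hg : (t⁻¹ • T (δ * Γ)) β₂ = 1 := by
    rw [LinearMap.smul_apply, hT, ht, smul_eq_mul, inv_mul_cancel₀ ht0]
  set S : ℂ := ∑ x, ZMod.stdAddChar (Q x) with hS
  have hSnorm : ‖(p : ℂ)⁻¹ * S‖ ^ 2 = (p : ℝ) ^ finrank (ZMod p) K := by
    rw [norm_mul, mul_pow, hS, norm_sq_sum_stdAddChar_quadraticForm hp, hrank, norm_inv,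
      Complex.norm_natCast, pow_add, inv_pow, mul_comm, mul_assoc,
      mul_inv_cancel₀ (pow_ne_zero 2 hp0), mul_one]
  -- The rank of `Q` is odd, so scaling by `a k` changes its exponential sum by the sign `χ (a k)`.
  have hodd : Odd (finrank (ZMod p) K - 2) := by
    obtain ⟨m, hm⟩ := hn_odd
    obtain ⟨j, hj⟩ := hn3
    exact ⟨m - 1, by omega⟩
  have hchi : ∀ k, a k ≠ 0 → (quadraticChar (ZMod p) (a k) : ℂ) ^ (finrank (ZMod p) K - 2)
      = quadraticChar (ZMod p) (a k) := fun k hk => by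
    rcases quadraticChar_dichotomy hk with h | h <;> simp [h, hodd.neg_one_pow]
  have main : ∀ b : K, ∃ h : ZMod p, fourierTransform F b
      = quadraticChar (ZMod p) (a (T b β₂)) * ((p : ℂ)⁻¹ * S) * ZMod.stdAddChar h := fun b => by
    obtain ⟨h, hh⟩ := exists_sum_glued_quadraticForm hp Q hker (T (δ * γ)) (t⁻¹ • T (δ * Γ))
      hf₁ hf₂ hg a ha' (T b)
    refine ⟨h, ?_⟩
    rw [sum_stdAddChar_smul_quadraticForm hp Q (ha' _), hrank, hchi _ (ha' _)] at hh
    have hL : fourierTransform F b = ∑ x, (ZMod.stdAddChar (a (T (δ * γ) x) * Q x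
        + T (δ * γ) x * (t⁻¹ • T (δ * Γ)) x - T b x) : ℂ) := by
      refine Finset.sum_congr rfl fun x _ => ?_
      rw [hF, hc', hQ, quadBinomialForm_apply, LinearMap.smul_apply, hT, hT, hT, smul_eq_mul,
        mul_assoc _ t⁻¹]
    rw [hL, hh]
    ring
  choose h hh using main
  refine ⟨fun b => ?_, ?_, ?_⟩
  · rw [hh, norm_mul, norm_mul, AddChar.norm_apply, mul_one, mul_pow, hSnorm]
    rcases quadraticChar_dichotomy (ha' (T b β₂)) with e | e <;> simp [e]
  · intro hF
    by_contra! hsq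
    refine hF (isWeaklyRegular_of_eq_mul_stdAddChar hSnorm h fun b => ?_)
    have hs : IsSquare (a (T b β₂)) := by
      by_cases hk : T b β₂ = 0
      · rw [hk, ha0]; exact IsSquare.one
      · exact hsq _ hk
    rw [hh, (quadraticChar_one_iff_isSquare (ha' _)).2 hs]
    simp
  · rintro ⟨k, -, hns⟩
    have hβ₂0 : β₂ ≠ 0 := by simpa using hβ.ne_zero 1
    obtain ⟨b, hb⟩ : ∃ b, T b β₂ = k := by
      obtain ⟨z, hz⟩ := Algebra.trace_surjective (ZMod p) K k
      exact ⟨z * β₂⁻¹, by rw [hT, inv_mul_cancel_right₀ hβ₂0, hz]⟩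
    have hC : (p : ℂ)⁻¹ * S ≠ 0 := fun h0 => by
      rw [h0, norm_zero, zero_pow two_ne_zero] at hSnorm
      exact pow_ne_zero _ hp0 hSnorm.symm
    refine not_isWeaklyRegular_of_opposite hp hC (b := 0) (b' := b) (h := h 0) (h' := h b) ?_ ?_
    · rw [hh, hT, zero_mul, map_zero, ha0, map_one]
      simp
    · rw [hh, hb, quadraticChar_neg_one_iff_not_isSquare.2 hns]
      simp
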